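/- Let $X\subset\mathbb{C}^n$ be a domain (a non-empty open connected set). A function $L:X\times X\to\mathbb{C}$ is *non-degenerate* if $L(x,x)>0$ for all $x\in X$, and *sesqui-holomorphic* if it is holomorphic in the first and antiholomorphic in the second variable. A non-degenerate function $M$ is a *rescaling* of a non-degenerate function $L$ if $M(x,y)=\omega(x)\overline{\omega(y)}L(x,y)$ on $X\times X$ for some function $\omega:X\to\mathbb{C}$. A *projectively invariant kernel* on $X$ is a sesqui-holomorphic, non-degenerate, positive semi-definite function $K:X\times X\to\mathbb{C}$ such that, for every automorphism $\Phi$ of $X$ (bijective holomorphic self-map), the function $(x,y)\mapsto K(\Phi(x),\Phi(y))$ is a rescaling of $K$. For $s\in\mathbb{R}$, the power $K^s$ is *well-defined* if there is a sesqui-holomorphic function $K^s$ on $X\times X$ such that $K^s(x,y)$ is one of the values of the multivalued power $K(x,y)^s$ for all $x,y\in X$ (with $0^s=0$ for $s>0$, $0^0=1$, and $0^s$ undefined for $s<0$) and such that $K^s(x,x)$ is the positive number $K(x,x)^s$ for all $x\in X$. Then: 1. If $K$ and $L$ are projectively invariant kernels on $X$, then so is their pointwise product $KL$. 2. If $M$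 is a rescaling of a projectively invariant kernel on $X$, then $M$ is positive semi-definite and $(x,y)\mapsto M(\Phi(x),\Phi(y))$ is a rescaling of $M$ for every automorphism $\Phi$ of $X$. In particular, if $M$ is in addition sesqui-holomorphic, then $M$ is a projectively invariant kernel. 3. If $K$ is a projectively invariant kernel on $X$, $s\in\mathbb{R}$, and $K^s$ is well-defined and positive semi-definite, then $K^s$ is a projectively invariant kernel. 4. If a net (in particular, a sequence) of projectively invariant kernels on $X$ converges in the compact-open topology, i.e. uniformly on compact subsets of $X\times X$, to a non-degenerate function $L$ on $X\times X$, then $L$ is a projectively invariant kernel. -/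

import Mathlib

open scoped ComplexOrder ComplexConjugate

namespace ProjKernel

/-! Functions on `X × X`, for a subset `X` of `ℂⁿ`, are represented by functions on the ambient
space; every notion below only looks at their values at points of `X`. -/

/-- `L` is non-degenerate on `X`: its diagonal values are (real and) strictly positive. -/
def IsNonDegenerate {n : ℕ} (X : Set (EuclideanSpace ℂ (Fin n)))
    (L : EuclideanSpace ℂ (Fin n) → EuclideanSpace ℂ (Fin n) → ℂ) : Prop :=
  ∀ x ∈ X, 0 < L x x

/-- `M` is a rescaling of `L` on `X`: both are non-degenerate and
`M(x, y) = ω(x) * conj (ω(y)) * L(x, y)` for some (arbitrary) function `ω`. -/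
def IsRescaling {n : ℕ} (X : Set (EuclideanSpace ℂ (Fin n)))
    (M L : EuclideanSpace ℂ (Fin n) → EuclideanSpace ℂ (Fin n) → ℂ) : Prop :=
  IsNonDegenerate X M ∧ IsNonDegenerate X L ∧
    ∃ ω : EuclideanSpace ℂ (Fin n) → ℂ,
      ∀ x ∈ X, ∀ y ∈ X, M x y = ω x * conj (ω y) * L x y

/-- `K` is positive semi-definite on `X`. -/
def IsPosSemidefKernel {n : ℕ} (X : Set (EuclideanSpace ℂ (Fin n)))
    (K : EuclideanSpace ℂ (Fin n) → EuclideanSpace ℂ (Fin n) → ℂ) : Prop :=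
  ∀ (m : ℕ) (x : Fin m → EuclideanSpace ℂ (Fin n)), (∀ i, x i ∈ X) →
    (Matrix.of fun i j => K (x i) (x j)).PosSemidef

/-- `L` is sesqui-holomorphic on `X`: holomorphic in the first variable and antiholomorphic
(the conjugate is holomorphic) in the second one. -/
def IsSesquiHolomorphic {n : ℕ} (X : Set (EuclideanSpace ℂ (Fin n)))
    (L : EuclideanSpace ℂ (Fin n) → EuclideanSpace ℂ (Fin n) → ℂ) : Prop :=
  (∀ y ∈ X, DifferentiableOn ℂ (fun x => L x y) X) ∧
    (∀ x ∈ X, DifferentiableOn ℂ (fun y => conj (L x y)) X)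

/-- `Φ` restricts to an automorphism of `X`: a bijective holomorphic self-map. -/
def IsAutomorphism {n : ℕ} (X : Set (EuclideanSpace ℂ (Fin n)))
    (Φ : EuclideanSpace ℂ (Fin n) → EuclideanSpace ℂ (Fin n)) : Prop :=
  Set.BijOn Φ X X ∧ DifferentiableOn ℂ Φ X

/-- The invariance property: `L ∘ Φ` is a rescaling of `L` for every automorphism `Φ` of `X`. -/
def IsRescaledByAut {n : ℕ} (X : Set (EuclideanSpace ℂ (Fin n)))
    (L : EuclideanSpace ℂ (Fin n) → EuclideanSpace ℂ (Fin n) → ℂ) : Prop :=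
  ∀ Φ : EuclideanSpace ℂ (Fin n) → EuclideanSpace ℂ (Fin n), IsAutomorphism X Φ →
    IsRescaling X (fun x y => L (Φ x) (Φ y)) L

/-- `K` is a projectively invariant kernel on `X`: a sesqui-holomorphic, non-degenerate,
positive semi-definite kernel such that `K ∘ Φ` is a rescaling of `K` for every automorphism. -/
structure IsProjInvKernel {n : ℕ} (X : Set (EuclideanSpace ℂ (Fin n)))
    (K : EuclideanSpace ℂ (Fin n) → EuclideanSpace ℂ (Fin n) → ℂ) : Prop where
  sesquiHolomorphic : IsSesquiHolomorphic X K
  nonDegenerate : IsNonDegenerate X K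
  posSemidef : IsPosSemidefKernel X K
  rescaledByAut : IsRescaledByAut X K

/-- `p` is one of the values of the multivalued power `z ^ s`, `s` real: `p = exp (s * w)` for some
logarithm `w` of `z` if `z ≠ 0`; and `0 ^ s = 0` for `s > 0`, `0 ^ 0 = 1`, while `0 ^ s` is
undefined for `s < 0`. -/
def IsPowerValue (s : ℝ) (z p : ℂ) : Prop :=
  (z ≠ 0 → ∃ w : ℂ, Complex.exp w = z ∧ p = Complex.exp ((s : ℂ) * w)) ∧
    (z = 0 → 0 ≤ s ∧ p = (((0 : ℝ) ^ s : ℝ) : ℂ))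

/-- The power `L ^ s` is well-defined on `X × X` and equal to `P`: `P` is a single-valued
sesqui-holomorphic branch of the multivalued function `L ^ s`, namely the one that on the diagonal
is the ordinary positive power of the positive number `L(x, x)`. -/
def IsPower {n : ℕ} (X : Set (EuclideanSpace ℂ (Fin n))) (s : ℝ)
    (L P : EuclideanSpace ℂ (Fin n) → EuclideanSpace ℂ (Fin n) → ℂ) : Prop :=
  IsSesquiHolomorphic X P ∧
    (∀ x ∈ X, ∀ y ∈ X, IsPowerValue s (L x y) (P x y)) ∧
    (∀ x ∈ X, P x x = (((L x x).re ^ s : ℝ) : ℂ))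

/-- `K i` converges to `L` along `l` in the compact-open topology of functions on `X × X`, i.e.
uniformly on every compact subset of `X × X`. -/
def CompactOpenTendsto {n : ℕ} {ι : Type*} (X : Set (EuclideanSpace ℂ (Fin n))) (l : Filter ι)
    (K : ι → EuclideanSpace ℂ (Fin n) → EuclideanSpace ℂ (Fin n) → ℂ)
    (L : EuclideanSpace ℂ (Fin n) → EuclideanSpace ℂ (Fin n) → ℂ) : Prop :=
  ∀ C : Set (EuclideanSpace ℂ (Fin n) × EuclideanSpace ℂ (Fin n)), IsCompact C → C ⊆ X ×ˢ X →
    TendstoUniformlyOn (fun i p => K i p.1 p.2) (fun p => L p.1 p.2) l C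

end ProjKernel

/-!
Rescaling a kernel does not change its cross-ratios `K x y * K z w / (K x w * K z y)`. Conversely,
let `P` and `Q` be Hermitian non-degenerate kernels on a domain with the same cross-ratios, and let
`P` be sesqui-holomorphic. Then `P` and `Q` have the same zeros and, with `R = Q / P` and a base
point `o`, the quotient `R x u / R o u` does not depend on the auxiliary point `u`; multiplied by
`√(R o o)` it is a rescaling function. Points `u` where all the values involved are non-zero exist
because finitely many holomorphic functions, none of them identically zero, have a common non-zero
point in a domain.

Equality of cross-ratios passes to pointwise limits. It also passes to powers: the two sides of
the cross-ratio identity for the powers are branches of the same multivalued function which agree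
for `x = z`, hence everywhere, since the quotient of two branches takes only countably many values.
-/

namespace ProjKernel

open Set Filter Topology Metric

section Holomorphic

variable {E F : Type*} [NormedAddCommGroup E] [NormedSpace ℂ E] [NormedAddCommGroup F]
  [NormedSpace ℂ F] {U : Set E}

theorem eqOn_of_convex_of_eventuallyEq [CompleteSpace F] {f g : E → F} (hf : DifferentiableOn ℂ f U)
    (hg : DifferentiableOn ℂ g U) (hU : IsOpen U) (hUc : Convex ℝ U) {p : E} (hp : p ∈ U)
    (hfg : f =ᶠ[𝓝 p] g) : EqOn f g U := by
  intro q hq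
  let line : ℂ → E := fun t => p + t • (q - p)
  have hline : Differentiable ℂ line := by fun_prop
  have hV : IsOpen (line ⁻¹' U) := hU.preimage hline.continuous
  have hVc : Convex ℝ (line ⁻¹' U) := (hUc.translate_preimage_right p).linear_preimage
    ((LinearMap.toSpanSingleton ℂ E (q - p)).restrictScalars ℝ)
  have analytic {h : E → F} (hh : DifferentiableOn ℂ h U) :
      AnalyticOnNhd ℂ (h ∘ line) (line ⁻¹' U) :=
    (hh.comp hline.differentiableOn fun _ ht => ht).analyticOnNhd hV
  have h0 : line 0 = p := by simp [line]
  have h1 : line 1 = q := by simp [line]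
  have hev : f ∘ line =ᶠ[𝓝 0] g ∘ line :=
    (hline.continuous.tendsto' 0 p h0).eventually hfg
  have heq : (f ∘ line) 1 = (g ∘ line) 1 :=
    (analytic hf).eqOn_of_preconnected_of_eventuallyEq (analytic hg) hVc.isPreconnected
      (mem_preimage.2 (h0 ▸ hp)) hev (mem_preimage.2 (h1 ▸ hq))
  simpa only [Function.comp_apply, h1] using heq

theorem eqOn_of_isPreconnected_of_eventuallyEq [CompleteSpace F] {f g : E → F}
    (hf : DifferentiableOn ℂ f U) (hg : DifferentiableOn ℂ g U) (hU : IsOpen U)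
    (hUc : IsPreconnected U) {z : E} (hz : z ∈ U) (hfg : f =ᶠ[𝓝 z] g) : EqOn f g U := by
  suffices U ⊆ {x | f =ᶠ[𝓝 x] g} from fun x hx => (this hx).self_of_nhds
  refine hUc.subset_of_closure_inter_subset isOpen_setOfPred_eventually_nhds ⟨z, hz, hfg⟩ ?_
  rintro x ⟨hxc, hxU⟩
  obtain ⟨r, hr, hrU⟩ := Metric.isOpen_iff.1 hU x hxU
  obtain ⟨p, hpx, hp⟩ := mem_closure_iff.1 hxc (ball x r) isOpen_ball (mem_ball_self hr)
  exact (eqOn_of_convex_of_eventuallyEq (hf.mono hrU) (hg.mono hrU) isOpen_ball (convex_ball x r)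
    hpx hp).eventuallyEq_of_mem (ball_mem_nhds x hr)

theorem exists_mul_ne_zero {f g : E → ℂ} (hf : DifferentiableOn ℂ f U)
    (hg : DifferentiableOn ℂ g U) (hU : IsOpen U) (hUc : IsPreconnected U)
    (hf0 : ∃ x ∈ U, f x ≠ 0) (hg0 : ∃ x ∈ U, g x ≠ 0) : ∃ x ∈ U, f x * g x ≠ 0 := by
  by_contra! hfg
  obtain ⟨a, ha, hfa⟩ := hf0
  obtain ⟨b, hb, hgb⟩ := hg0
  refine hgb (eqOn_of_isPreconnected_of_eventuallyEq hg (differentiableOn_const 0) hU hUc ha ?_ hb)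
  have hfa' : ∀ᶠ x in 𝓝 a, f x ≠ 0 :=
    (hf.continuousOn.continuousAt (hU.mem_nhds ha)).eventually_ne hfa
  filter_upwards [hfa', hU.mem_nhds ha] with x hx hxU
  exact (mul_eq_zero.1 (hfg x hxU)).resolve_left hx

theorem uniformCauchySeqOn_fderiv {ι : Type*} {l : Filter ι} {f : ι → E → F} {x : E} {r R : ℝ}
    (hrR : r < R) (hf : ∀ i, DifferentiableOn ℂ (f i) (ball x R))
    (hcauchy : UniformCauchySeqOn f l (ball x R)) :
    UniformCauchySeqOn (fun i => fderiv ℂ (f i)) l (ball x r) := by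
  intro u hu
  obtain ⟨ε, hε, hεu⟩ := Metric.mem_uniformity_dist.1 hu
  set δ := R - r
  have hδ : 0 < δ := sub_pos.2 hrR
  filter_upwards [hcauchy _ (Metric.dist_mem_uniformity (show 0 < ε * δ / 4 by positivity))]
    with ij hij y hy
  have hsub : ball y δ ⊆ ball x R :=
    ball_subset_ball' (by linarith [mem_ball.1 hy, show δ = R - r from rfl])
  have hyR : ball x R ∈ 𝓝 y := isOpen_ball.mem_nhds (hsub (mem_ball_self hδ))
  have hmaps : MapsTo (f ij.1 - f ij.2) (ball y δ)
      (closedBall ((f ij.1 - f ij.2) y) (ε * δ / 4 + ε * δ / 4)) := by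
    intro z hz
    have hz' := hij z (hsub hz)
    have hy' := hij y (hsub (mem_ball_self hδ))
    rw [dist_eq_norm_sub] at hz' hy'
    rw [mem_closedBall, dist_eq_norm_sub]
    exact (norm_sub_le _ _).trans (add_le_add hz'.le hy'.le)
  refine hεu ?_
  calc dist (fderiv ℂ (f ij.1) y) (fderiv ℂ (f ij.2) y)
      = ‖fderiv ℂ (f ij.1 - f ij.2) y‖ := by
        rw [dist_eq_norm_sub,
          fderiv_sub ((hf _).differentiableAt hyR) ((hf _).differentiableAt hyR)]
    _ ≤ (ε * δ / 4 + ε * δ / 4) / δ :=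
        Complex.norm_fderiv_le_div_of_mapsTo_ball (((hf _).sub (hf _)).mono hsub) hmaps hδ
    _ = ε / 2 := by field_simp; ring
    _ < ε := half_lt_self hε

theorem differentiableOn_of_tendstoLocallyUniformlyOn [LocallyCompactSpace E] [CompleteSpace F]
    {ι : Type*} {l : Filter ι} [l.NeBot] {f : ι → E → F} {g : E → F} (hU : IsOpen U)
    (hf : ∀ i, DifferentiableOn ℂ (f i) U) (hlim : TendstoLocallyUniformlyOn f g l U) :
    DifferentiableOn ℂ g U := by
  intro x hx
  obtain ⟨V, ⟨hV, hVc⟩, hVU⟩ := (compact_basis_nhds x).mem_iff.1 (hU.mem_nhds hx)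
  obtain ⟨R, hR, hRV⟩ := Metric.mem_nhds_iff.1 hV
  have hunif : TendstoUniformlyOn f g l (ball x R) :=
    ((tendstoLocallyUniformlyOn_iff_forall_isCompact hU).1 hlim V hVU hVc).mono hRV
  have hdiff (i : ι) : DifferentiableOn ℂ (f i) (ball x R) := (hf i).mono (hRV.trans hVU)
  have hsub : ball x (R / 2) ⊆ ball x R := ball_subset_ball (half_le_self hR.le)
  have hcauchy := uniformCauchySeqOn_fderiv (half_lt_self hR) hdiff hunif.uniformCauchySeqOn
  choose! g' hg' using fun y (hy : y ∈ ball x (R / 2)) =>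
    cauchy_map_iff_exists_tendsto.1 (hcauchy.cauchy_map hy)
  have hderiv : HasFDerivAt g (g' x) x :=
    hasFDerivAt_of_tendstoUniformlyOn isOpen_ball (hcauchy.tendstoUniformlyOn_of_tendsto hg')
      (fun i y hy => ((hdiff i).differentiableAt (isOpen_ball.mem_nhds (hsub hy))).hasFDerivAt)
      (fun y hy => hunif.tendsto_at (hsub hy)) (mem_ball_self (half_pos hR))
  exact hderiv.differentiableAt.differentiableWithinAt

end Holomorphic

section PowerValues

variable {s : ℝ} {z z' p p' q : ℂ}

theorem IsPowerValue.eq_zero_iff (h : IsPowerValue s z p) : p = 0 ↔ z = 0 ∧ s ≠ 0 := by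
  by_cases hz : z = 0
  · simp [(h.2 hz).2, hz, Real.rpow_eq_zero_iff_of_nonneg]
  · obtain ⟨w, -, rfl⟩ := h.1 hz
    simp [hz]

theorem IsPowerValue.eq_one (h : IsPowerValue 0 z p) : p = 1 := by
  by_cases hz : z = 0
  · simpa using (h.2 hz).2
  · obtain ⟨w, -, rfl⟩ := h.1 hz
    simp

theorem IsPowerValue.mul (h : IsPowerValue s z p) (h' : IsPowerValue s z' p') :
    IsPowerValue s (z * z') (p * p') := by
  refine ⟨fun hzz => ?_, fun hzz => ?_⟩
  · obtain ⟨hz, hz'⟩ := mul_ne_zero_iff.1 hzz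
    obtain ⟨w, rfl, rfl⟩ := h.1 hz
    obtain ⟨w', rfl, rfl⟩ := h'.1 hz'
    exact ⟨w + w', Complex.exp_add w w', by rw [mul_add, Complex.exp_add]⟩
  · have hs : 0 ≤ s := (mul_eq_zero.1 hzz).elim (fun hz => (h.2 hz).1) fun hz' => (h'.2 hz').1
    refine ⟨hs, ?_⟩
    rcases eq_or_ne s 0 with rfl | hs0
    · rw [h.eq_one, h'.eq_one, mul_one, Real.rpow_zero, Complex.ofReal_one]
    · rw [Real.zero_rpow hs0, Complex.ofReal_zero, mul_eq_zero, h.eq_zero_iff, h'.eq_zero_iff]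
      exact (mul_eq_zero.1 hzz).imp (⟨·, hs0⟩) (⟨·, hs0⟩)

theorem IsPowerValue.exists_eq_exp_mul (hp : IsPowerValue s z p) (hq : IsPowerValue s z q) :
    ∃ k : ℤ, p = Complex.exp (s * (k * (2 * Real.pi * Complex.I))) * q := by
  by_cases hz : z = 0
  · exact ⟨0, by simp [(hp.2 hz).2, (hq.2 hz).2]⟩
  · obtain ⟨w, hw, rfl⟩ := hp.1 hz
    obtain ⟨w', hw', rfl⟩ := hq.1 hz
    obtain ⟨k, rfl⟩ := Complex.exp_eq_exp_iff_exists_int.1 (hw.trans hw'.symm)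
    exact ⟨k, by rw [← Complex.exp_add]; ring_nf⟩

theorem eventually_eq_of_countable_image {E Y : Type*} [TopologicalSpace E]
    [LocallyConnectedSpace E] [MetricSpace Y] {h : E → Y} {U : Set E} (hU : IsOpen U)
    (hh : ContinuousOn h U) (hcount : (h '' U).Countable) {z : E} (hz : z ∈ U) :
    ∀ᶠ x in 𝓝 z, h x = h z := by
  obtain ⟨V, hV, hVc, hVU⟩ := locallyConnectedSpace_iff_connected_subsets.1 ‹_› z U (hU.mem_nhds hz)
  filter_upwards [hV] with x hx
  exact hcount.isTotallyDisconnected _ (image_mono hVU) (hVc.image h (hh.mono hVU))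
    (mem_image_of_mem h hx) (mem_image_of_mem h (mem_of_mem_nhds hV))

theorem eqOn_of_isPowerValue {E : Type*} [NormedAddCommGroup E] [NormedSpace ℂ E] {U : Set E}
    {F f g : E → ℂ} (hU : IsOpen U) (hUc : IsPreconnected U) (hf : DifferentiableOn ℂ f U)
    (hg : DifferentiableOn ℂ g U) (hfF : ∀ x ∈ U, IsPowerValue s (F x) (f x))
    (hgF : ∀ x ∈ U, IsPowerValue s (F x) (g x)) {a : E} (ha : a ∈ U) (hfga : f a = g a)
    (hga : g a ≠ 0) : EqOn f g U := by
  set V := U ∩ g ⁻¹' {0}ᶜ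
  have hV : IsOpen V := hg.continuousOn.isOpen_inter_preimage hU isOpen_compl_singleton
  have hcount : ((fun x => f x / g x) '' V).Countable := by
    refine (countable_range fun k : ℤ =>
      Complex.exp (s * (k * (2 * Real.pi * Complex.I)))).mono ?_
    rintro _ ⟨x, ⟨hxU, hgx⟩, rfl⟩
    obtain ⟨k, hk⟩ := (hfF x hxU).exists_eq_exp_mul (hgF x hxU)
    exact ⟨k, ((div_eq_iff hgx).2 hk).symm⟩
  have hcont : ContinuousOn (fun x => f x / g x) V :=
    (hf.continuousOn.mono inter_subset_left).div (hg.continuousOn.mono inter_subset_left)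
      fun x hx => hx.2
  refine eqOn_of_isPreconnected_of_eventuallyEq hf hg hU hUc ha ?_
  filter_upwards [eventually_eq_of_countable_image hV hcont hcount ⟨ha, hga⟩,
    hV.mem_nhds ⟨ha, hga⟩] with x hx hxV
  rwa [hfga, div_self hga, div_eq_one_iff_eq hxV.2] at hx

end PowerValues

section CrossRatio

variable {α : Type*} {S : Set α} {P Q : α → α → ℂ}

/-- The kernel `K` is Hermitian on `S`. -/
def IsHermitianOn (S : Set α) (K : α → α → ℂ) : Prop :=
  ∀ x ∈ S, ∀ y ∈ S, conj (K x y) = K y x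

/-- The kernels `K` and `L` have the same cross-ratios
`K x y * K z w / (K x w * K z y) = L x y * L z w / (L x w * L z y)` on `S`. Denominators are
cleared, so kernels with zeros are allowed. -/
def SameCrossRatio (S : Set α) (K L : α → α → ℂ) : Prop :=
  ∀ x ∈ S, ∀ y ∈ S, ∀ z ∈ S, ∀ w ∈ S,
    K x y * K z w * (L x w * L z y) = L x y * L z w * (K x w * K z y)

theorem SameCrossRatio.eq_zero_iff (h : SameCrossRatio S Q P) (hQ : IsHermitianOn S Q)
    (hP : IsHermitianOn S P) (hQ0 : ∀ x ∈ S, Q x x ≠ 0) (hP0 : ∀ x ∈ S, P x x ≠ 0) {x y : α}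
    (hx : x ∈ S) (hy : y ∈ S) : Q x y = 0 ↔ P x y = 0 := by
  have hxy := h x hx y hy y hy x hx
  rw [← hQ x hx y hy, ← hP x hx y hy] at hxy
  constructor <;> intro h0 <;> simpa [h0, hQ0 x hx, hQ0 y hy, hP0 x hx, hP0 y hy] using hxy

theorem SameCrossRatio.div_mul_div (h : SameCrossRatio S Q P) {x y z w : α} (hx : x ∈ S)
    (hy : y ∈ S) (hz : z ∈ S) (hw : w ∈ S) (hxy : P x y ≠ 0) (hzw : P z w ≠ 0) (hxw : P x w ≠ 0)
    (hzy : P z y ≠ 0) :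
    Q x y / P x y * (Q z w / P z w) = Q x w / P x w * (Q z y / P z y) := by
  field_simp
  linear_combination h x hx y hy z hz w hw

theorem SameCrossRatio.of_tendsto {ι : Type*} {l : Filter ι} [l.NeBot] {F G : ι → α → α → ℂ}
    (h : ∀ i, SameCrossRatio S (G i) (F i))
    (hG : ∀ x ∈ S, ∀ y ∈ S, Tendsto (fun i => G i x y) l (𝓝 (Q x y)))
    (hF : ∀ x ∈ S, ∀ y ∈ S, Tendsto (fun i => F i x y) l (𝓝 (P x y))) : SameCrossRatio S Q P :=
  fun x hx y hy z hz w hw => tendsto_nhds_unique_of_eventuallyEq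
    (((hG x hx y hy).mul (hG z hz w hw)).mul ((hF x hx w hw).mul (hF z hz y hy)))
    (((hF x hx y hy).mul (hF z hz w hw)).mul ((hG x hx w hw).mul (hG z hz y hy)))
    (.of_forall fun i => h i x hx y hy z hz w hw)

theorem exists_mul_conj_eq {a : ℂ} (ha : 0 ≤ a) : ∃ c : ℂ, c * conj c = a := by
  refine ⟨√a.re, ?_⟩
  rw [Complex.conj_ofReal, ← Complex.ofReal_mul, Real.mul_self_sqrt (Complex.nonneg_iff.1 ha).1]
  exact (Complex.eq_re_of_ofReal_le ha).symm

theorem SameCrossRatio.exists_div_eq_mul (h : SameCrossRatio S Q P) {x o : α} (hx : x ∈ S)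
    (ho : o ∈ S) (hQP : ∀ u ∈ S, Q o u = 0 → P o u = 0) :
    ∃ t, ∀ u ∈ S, P x u ≠ 0 → P o u ≠ 0 → Q x u / P x u = t * (Q o u / P o u) := by
  by_cases hlink : ∃ v ∈ S, P x v ≠ 0 ∧ P o v ≠ 0
  · obtain ⟨v, hv, hxv, hov⟩ := hlink
    refine ⟨Q x v / P x v / (Q o v / P o v), fun u hu hxu hou => ?_⟩
    have hov' : Q o v / P o v ≠ 0 := div_ne_zero (mt (hQP v hv) hov) hov
    rw [div_mul_eq_mul_div, eq_div_iff hov']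
    exact h.div_mul_div hx hu ho hv hxu hov hxv hou
  · exact ⟨0, fun u hu hxu hou => absurd ⟨u, hu, hxu, hou⟩ hlink⟩

theorem SameCrossRatio.exists_eq_mul_conj_mul (h : SameCrossRatio S Q P) (hQ : IsHermitianOn S Q)
    (hP : IsHermitianOn S P) (hQ0 : ∀ x ∈ S, 0 < Q x x) (hP0 : ∀ x ∈ S, 0 < P x x)
    (hlink : ∀ x ∈ S, ∀ y ∈ S, ∀ z ∈ S, ∃ u ∈ S, P x u ≠ 0 ∧ P y u ≠ 0 ∧ P z u ≠ 0) :
    ∃ ω : α → ℂ, ∀ x ∈ S, ∀ y ∈ S, Q x y = ω x * conj (ω y) * P x y := by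
  rcases S.eq_empty_or_nonempty with rfl | ⟨o, ho⟩
  · exact ⟨0, by simp⟩
  have hzero {x y} (hx : x ∈ S) (hy : y ∈ S) : Q x y = 0 ↔ P x y = 0 :=
    h.eq_zero_iff hQ hP (fun x hx => (hQ0 x hx).ne') (fun x hx => (hP0 x hx).ne') hx hy
  have hPswap {x y} (hx : x ∈ S) (hy : y ∈ S) (hxy : P x y ≠ 0) : P y x ≠ 0 := by
    rwa [← hP x hx y hy, Ne, map_eq_zero]
  let R x y := Q x y / P x y
  have hRconj {x y} (hx : x ∈ S) (hy : y ∈ S) : conj (R x y) = R y x := by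
    simp only [R, map_div₀, hQ x hx y hy, hP x hx y hy]
  obtain ⟨c, hc⟩ : ∃ c : ℂ, c * conj c = R o o :=
    exists_mul_conj_eq (div_nonneg (hQ0 o ho).le (hP0 o ho).le)
  choose! t ht using fun x (hx : x ∈ S) =>
    h.exists_div_eq_mul hx ho fun u hu => (hzero ho hu).1
  refine ⟨fun x => c * t x, fun x hx y hy => ?_⟩
  by_cases hxy : P x y = 0
  · rw [(hzero hx hy).2 hxy, hxy, mul_zero]
  rw [← div_eq_iff hxy]
  obtain ⟨u, hu, hxu, hyu, hou⟩ := hlink x hx y hy o ho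
  have huu : P u u ≠ 0 := (hP0 u hu).ne'
  have hxt : R x u = t x * R o u := ht x hx u hu hxu hou
  have hyt : R u y = conj (t y) * R u o := by
    rw [← hRconj hy hu, ← hRconj ho hu, ← map_mul]
    exact congrArg conj (ht y hy u hu hyu hou)
  refine mul_right_cancel₀ (div_ne_zero (hQ0 u hu).ne' huu) ?_
  calc R x y * R u u = R x u * R u y :=
        h.div_mul_div hx hy hu hu hxy huu hxu (hPswap hy hu hyu)
    _ = t x * conj (t y) * (R o u * R u o) := by rw [hxt, hyt]; ring
    _ = t x * conj (t y) * (R o o * R u u) := by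
        congr 1
        exact (h.div_mul_div ho ho hu hu (hP0 o ho).ne' huu hou (hPswap ho hu hou)).symm
    _ = c * t x * conj (c * t y) * R u u := by rw [← hc, map_mul]; ring

end CrossRatio

section Kernels

variable {n : ℕ} {X : Set (EuclideanSpace ℂ (Fin n))}
  {K L M N P Q : EuclideanSpace ℂ (Fin n) → EuclideanSpace ℂ (Fin n) → ℂ}
  {Φ : EuclideanSpace ℂ (Fin n) → EuclideanSpace ℂ (Fin n)} {s : ℝ}

theorem isClosed_setOf_posSemidef {m 𝕜 : Type*} [RCLike 𝕜] :
    IsClosed {A : Matrix m m 𝕜 | A.PosSemidef} := by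
  simp only [Matrix.PosSemidef, Matrix.IsHermitian, Finsupp.sum, ofPred_and, ofPred_forall]
  exact (isClosed_eq (by fun_prop) continuous_id).inter
    (isClosed_iInter fun v => isClosed_le continuous_const (by fun_prop))

theorem IsPosSemidefKernel.isHermitianOn (hK : IsPosSemidefKernel X K) : IsHermitianOn X K := by
  intro x hx y hy
  have hpair : ∀ i, ![x, y] i ∈ X := by simp [Fin.forall_fin_two, hx, hy]
  simpa using (hK 2 ![x, y] hpair).isHermitian.apply 1 0

theorem IsPosSemidefKernel.comp (hK : IsPosSemidefKernel X K) (hΦ : MapsTo Φ X X) :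
    IsPosSemidefKernel X (fun x y => K (Φ x) (Φ y)) :=
  fun m x hx => hK m (Φ ∘ x) fun i => hΦ (hx i)

theorem IsPosSemidefKernel.mul (hK : IsPosSemidefKernel X K) (hL : IsPosSemidefKernel X L) :
    IsPosSemidefKernel X (fun x y => K x y * L x y) :=
  fun m x hx => (hK m x hx).hadamard (hL m x hx)

theorem IsPosSemidefKernel.of_isRescaling (hK : IsPosSemidefKernel X K) (hM : IsRescaling X M K) :
    IsPosSemidefKernel X M := by
  obtain ⟨-, -, ω, hω⟩ := hM
  intro m x hx
  have hconj : (Matrix.of fun i j => M (x i) (x j)) =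
      Matrix.diagonal (fun i => ω (x i)) * (Matrix.of fun i j => K (x i) (x j)) *
        (Matrix.diagonal fun i => ω (x i)).conjTranspose := by
    ext i j
    simp [Matrix.diagonal_conjTranspose, hω _ (hx i) _ (hx j), mul_right_comm]
  exact hconj ▸ (hK m x hx).mul_mul_conjTranspose_same _

theorem IsPosSemidefKernel.of_tendsto {ι : Type*} {l : Filter ι} [l.NeBot]
    {F : ι → EuclideanSpace ℂ (Fin n) → EuclideanSpace ℂ (Fin n) → ℂ}
    (hF : ∀ i, IsPosSemidefKernel X (F i))
    (hlim : ∀ x ∈ X, ∀ y ∈ X, Tendsto (fun i => F i x y) l (𝓝 (L x y))) :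
    IsPosSemidefKernel X L := fun m x hx =>
  isClosed_setOf_posSemidef.mem_of_tendsto
    (tendsto_pi_nhds.2 fun i => tendsto_pi_nhds.2 fun j => hlim _ (hx i) _ (hx j))
    (.of_forall fun k => hF k m x hx)

theorem IsNonDegenerate.comp (hK : IsNonDegenerate X K) (hΦ : MapsTo Φ X X) :
    IsNonDegenerate X (fun x y => K (Φ x) (Φ y)) := fun _ hx => hK _ (hΦ hx)

theorem IsNonDegenerate.mul (hK : IsNonDegenerate X K) (hL : IsNonDegenerate X L) :
    IsNonDegenerate X (fun x y => K x y * L x y) := fun x hx => mul_pos (hK x hx) (hL x hx)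

theorem IsSesquiHolomorphic.comp (hK : IsSesquiHolomorphic X K) (hΦ : IsAutomorphism X Φ) :
    IsSesquiHolomorphic X (fun x y => K (Φ x) (Φ y)) :=
  ⟨fun _ hy => (hK.1 _ (hΦ.1.mapsTo hy)).comp hΦ.2 hΦ.1.mapsTo,
    fun _ hx => (hK.2 _ (hΦ.1.mapsTo hx)).comp hΦ.2 hΦ.1.mapsTo⟩

theorem IsSesquiHolomorphic.mul (hK : IsSesquiHolomorphic X K) (hL : IsSesquiHolomorphic X L) :
    IsSesquiHolomorphic X (fun x y => K x y * L x y) :=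
  ⟨fun y hy => (hK.1 y hy).mul (hL.1 y hy), fun x hx =>
    ((hK.2 x hx).mul (hL.2 x hx)).congr fun _ _ => map_mul _ _ _⟩

theorem IsHermitianOn.isSesquiHolomorphic (hK : IsHermitianOn X K)
    (hleft : ∀ y ∈ X, DifferentiableOn ℂ (fun x => K x y) X) : IsSesquiHolomorphic X K :=
  ⟨hleft, fun x hx => (hleft x hx).congr fun y hy => hK x hx y hy⟩

theorem IsRescaling.symm (h : IsRescaling X M L) : IsRescaling X L M := by
  obtain ⟨hM, hL, ω, hω⟩ := h
  have hω0 : ∀ x ∈ X, ω x ≠ 0 := fun x hx h0 => by simpa [hω x hx x hx, h0] using hM x hx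
  refine ⟨hL, hM, fun x => (ω x)⁻¹, fun x hx y hy => ?_⟩
  have hx0 := hω0 x hx
  have hy0 : conj (ω y) ≠ 0 := (map_ne_zero _).2 (hω0 y hy)
  rw [hω x hx y hy, map_inv₀]
  field_simp

theorem IsRescaling.trans (h : IsRescaling X M L) (h' : IsRescaling X L K) :
    IsRescaling X M K := by
  obtain ⟨hM, -, ω, hω⟩ := h
  obtain ⟨-, hK, η, hη⟩ := h'
  refine ⟨hM, hK, fun x => ω x * η x, fun x hx y hy => ?_⟩
  rw [hω x hx y hy, hη x hx y hy, map_mul]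
  ring

theorem IsRescaling.mul (h : IsRescaling X M K) (h' : IsRescaling X N L) :
    IsRescaling X (fun x y => M x y * N x y) (fun x y => K x y * L x y) := by
  obtain ⟨hM, hK, ω, hω⟩ := h
  obtain ⟨hN, hL, η, hη⟩ := h'
  refine ⟨hM.mul hN, hK.mul hL, fun x => ω x * η x, fun x hx y hy => ?_⟩
  simp only [hω x hx y hy, hη x hx y hy, map_mul]
  ring

theorem IsRescaling.comp (h : IsRescaling X M L) (hΦ : MapsTo Φ X X) :
    IsRescaling X (fun x y => M (Φ x) (Φ y)) (fun x y => L (Φ x) (Φ y)) :=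
  let ⟨hM, hL, ω, hω⟩ := h
  ⟨hM.comp hΦ, hL.comp hΦ, ω ∘ Φ, fun _ hx _ hy => hω _ (hΦ hx) _ (hΦ hy)⟩

theorem IsRescaling.sameCrossRatio (h : IsRescaling X M L) : SameCrossRatio X M L := by
  obtain ⟨-, -, ω, hω⟩ := h
  intro x hx y hy z hz w hw
  rw [hω x hx y hy, hω z hz w hw, hω x hx w hw, hω z hz y hy]
  ring

theorem IsRescaledByAut.of_isRescaling (hK : IsRescaledByAut X K) (hM : IsRescaling X M K) :
    IsRescaledByAut X M :=
  fun Φ hΦ => (hM.comp hΦ.1.mapsTo).trans ((hK Φ hΦ).trans hM.symm)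

theorem IsProjInvKernel.mul (hK : IsProjInvKernel X K) (hL : IsProjInvKernel X L) :
    IsProjInvKernel X (fun x y => K x y * L x y) where
  sesquiHolomorphic := hK.sesquiHolomorphic.mul hL.sesquiHolomorphic
  nonDegenerate := hK.nonDegenerate.mul hL.nonDegenerate
  posSemidef := hK.posSemidef.mul hL.posSemidef
  rescaledByAut Φ hΦ := (hK.rescaledByAut Φ hΦ).mul (hL.rescaledByAut Φ hΦ)

theorem IsSesquiHolomorphic.exists_ne_zero (hP : IsSesquiHolomorphic X P) (hXo : IsOpen X)
    (hXc : IsPreconnected X) (hP0 : IsNonDegenerate X P) {x y z : EuclideanSpace ℂ (Fin n)}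
    (hx : x ∈ X) (hy : y ∈ X) (hz : z ∈ X) : ∃ u ∈ X, P u x ≠ 0 ∧ P u y ≠ 0 ∧ P u z ≠ 0 := by
  have hne : ∀ a ∈ X, ∃ u ∈ X, P u a ≠ 0 := fun a ha => ⟨a, ha, (hP0 a ha).ne'⟩
  have hyz := exists_mul_ne_zero (hP.1 y hy) (hP.1 z hz) hXo hXc (hne y hy) (hne z hz)
  obtain ⟨u, hu, hxyz⟩ := exists_mul_ne_zero (hP.1 x hx) ((hP.1 y hy).fun_mul (hP.1 z hz)) hXo hXc
    (hne x hx) hyz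
  exact ⟨u, hu, by simpa only [mul_ne_zero_iff] using hxyz⟩

theorem SameCrossRatio.isRescaling (h : SameCrossRatio X Q P) (hXo : IsOpen X)
    (hXc : IsPreconnected X) (hQ : IsHermitianOn X Q) (hP : IsHermitianOn X P)
    (hQ0 : IsNonDegenerate X Q) (hP0 : IsNonDegenerate X P) (hPhol : IsSesquiHolomorphic X P) :
    IsRescaling X Q P := by
  refine ⟨hQ0, hP0, h.exists_eq_mul_conj_mul hQ hP hQ0 hP0 fun x hx y hy z hz => ?_⟩
  obtain ⟨u, hu, hxyz⟩ := hPhol.exists_ne_zero hXo hXc hP0 hx hy hz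
  refine ⟨u, hu, ?_⟩
  rwa [← hP u hu x hx, ← hP u hu y hy, ← hP u hu z hz, map_ne_zero, map_ne_zero, map_ne_zero]

theorem IsProjInvKernel.of_sameCrossRatio (hXo : IsOpen X) (hXc : IsPreconnected X)
    (hhol : IsSesquiHolomorphic X P) (hP0 : IsNonDegenerate X P) (hpos : IsPosSemidefKernel X P)
    (h : ∀ Φ, IsAutomorphism X Φ → SameCrossRatio X (fun x y => P (Φ x) (Φ y)) P) :
    IsProjInvKernel X P where
  sesquiHolomorphic := hhol
  nonDegenerate := hP0
  posSemidef := hpos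
  rescaledByAut Φ hΦ := (h Φ hΦ).isRescaling hXo hXc (hpos.comp hΦ.1.mapsTo).isHermitianOn
    hpos.isHermitianOn (hP0.comp hΦ.1.mapsTo) hP0 hhol

theorem IsPower.isNonDegenerate (hP : IsPower X s K P) (hK : IsNonDegenerate X K) :
    IsNonDegenerate X P := fun x hx => by
  rw [hP.2.2 x hx]
  exact_mod_cast Real.rpow_pos_of_pos (Complex.pos_iff.1 (hK x hx)).1 s

theorem IsPower.comp (hP : IsPower X s K P) (hΦ : IsAutomorphism X Φ) :
    IsPower X s (fun x y => K (Φ x) (Φ y)) (fun x y => P (Φ x) (Φ y)) :=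
  ⟨hP.1.comp hΦ, fun _ hx _ hy => hP.2.1 _ (hΦ.1.mapsTo hx) _ (hΦ.1.mapsTo hy),
    fun _ hx => hP.2.2 _ (hΦ.1.mapsTo hx)⟩

theorem IsPower.sameCrossRatio (hXo : IsOpen X) (hXc : IsPreconnected X) (hP : IsPower X s K P)
    (hQ : IsPower X s L Q) (hzero : ∀ x ∈ X, ∀ y ∈ X, L x y = 0 ↔ K x y = 0)
    (h : SameCrossRatio X L K) : SameCrossRatio X Q P := by
  intro x hx y hy z hz w hw
  have hPval {a b} (ha : a ∈ X) (hb : b ∈ X) := hP.2.1 a ha b hb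
  have hQval {a b} (ha : a ∈ X) (hb : b ∈ X) := hQ.2.1 a ha b hb
  have hQP {a b} (ha : a ∈ X) (hb : b ∈ X) : Q a b = 0 ↔ P a b = 0 := by
    rw [(hQval ha hb).eq_zero_iff, (hPval ha hb).eq_zero_iff, hzero a ha b hb]
  by_cases hzy : P z y = 0
  · simp [hzy, (hQP hz hy).2 hzy]
  by_cases hzw : P z w = 0
  · simp [hzw, (hQP hz hw).2 hzw]
  refine eqOn_of_isPowerValue (s := s) (F := fun x => L x y * L z w * (K x w * K z y))
    (f := fun x => Q x y * Q z w * (P x w * P z y))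
    (g := fun x => P x y * P z w * (Q x w * Q z y)) hXo hXc
    (((hQ.1.1 y hy).mul_const _).mul ((hP.1.1 w hw).mul_const _))
    (((hP.1.1 y hy).mul_const _).mul ((hQ.1.1 w hw).mul_const _)) (fun a ha => ?_) (fun a ha => ?_)
    hz ?_ ?_ hx
  · exact ((hQval ha hy).mul (hQval hz hw)).mul ((hPval ha hw).mul (hPval hz hy))
  · rw [h a ha y hy z hz w hw]
    exact ((hPval ha hy).mul (hPval hz hw)).mul ((hQval ha hw).mul (hQval hz hy))
  · ring
  · simp [hQP hz hy, hQP hz hw, hzy, hzw]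

theorem IsProjInvKernel.power (hXo : IsOpen X) (hXc : IsPreconnected X) (hK : IsProjInvKernel X K)
    (hP : IsPower X s K P) (hPs : IsPosSemidefKernel X P) : IsProjInvKernel X P := by
  refine .of_sameCrossRatio hXo hXc hP.1 (hP.isNonDegenerate hK.nonDegenerate) hPs fun Φ hΦ => ?_
  have hcross := (hK.rescaledByAut Φ hΦ).sameCrossRatio
  refine hP.sameCrossRatio hXo hXc (hP.comp hΦ) (fun x hx y hy => ?_) hcross
  exact hcross.eq_zero_iff (hK.posSemidef.comp hΦ.1.mapsTo).isHermitianOn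
    hK.posSemidef.isHermitianOn (fun a ha => (hK.nonDegenerate _ (hΦ.1.mapsTo ha)).ne')
    (fun a ha => (hK.nonDegenerate a ha).ne') hx hy

section Limits

variable {ι : Type*} {l : Filter ι}
  {F : ι → EuclideanSpace ℂ (Fin n) → EuclideanSpace ℂ (Fin n) → ℂ}

theorem CompactOpenTendsto.tendsto (h : CompactOpenTendsto X l F L)
    {x y : EuclideanSpace ℂ (Fin n)} (hx : x ∈ X) (hy : y ∈ X) :
    Tendsto (fun i => F i x y) l (𝓝 (L x y)) :=
  (h {(x, y)} isCompact_singleton (by simp [hx, hy])).tendsto_at (mem_singleton (x, y))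

theorem CompactOpenTendsto.tendstoLocallyUniformlyOn_left (h : CompactOpenTendsto X l F L)
    (hXo : IsOpen X) {y : EuclideanSpace ℂ (Fin n)} (hy : y ∈ X) :
    TendstoLocallyUniformlyOn (fun i x => F i x y) (fun x => L x y) l X := by
  refine (tendstoLocallyUniformlyOn_iff_forall_isCompact hXo).2 fun C hCX hC => ?_
  have hprod := h (C ×ˢ {y}) (hC.prod isCompact_singleton)
    (prod_mono hCX (singleton_subset_iff.2 hy))
  exact (hprod.comp fun x => (x, y)).mono fun x hx => ⟨hx, rfl⟩

theorem IsProjInvKernel.of_compactOpenTendsto [l.NeBot] (hXo : IsOpen X) (hXc : IsPreconnected X)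
    (hF : ∀ i, IsProjInvKernel X (F i)) (h : CompactOpenTendsto X l F L)
    (hL : IsNonDegenerate X L) : IsProjInvKernel X L := by
  have hlim : ∀ x ∈ X, ∀ y ∈ X, Tendsto (fun i => F i x y) l (𝓝 (L x y)) :=
    fun x hx y hy => h.tendsto hx hy
  have hpos : IsPosSemidefKernel X L := .of_tendsto (fun i => (hF i).posSemidef) hlim
  have hhol : IsSesquiHolomorphic X L := hpos.isHermitianOn.isSesquiHolomorphic fun y hy =>
    differentiableOn_of_tendstoLocallyUniformlyOn hXo (fun i => (hF i).sesquiHolomorphic.1 y hy)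
      (h.tendstoLocallyUniformlyOn_left hXo hy)
  exact .of_sameCrossRatio hXo hXc hhol hL hpos fun Φ hΦ =>
    .of_tendsto (fun i => ((hF i).rescaledByAut Φ hΦ).sameCrossRatio)
      (fun x hx y hy => hlim _ (hΦ.1.mapsTo hx) _ (hΦ.1.mapsTo hy)) hlim

end Limits

end Kernels

end ProjKernel

theorem mainTheorem7 {n : ℕ} (X : Set (EuclideanSpace ℂ (Fin n)))
    (hXo : IsOpen X) (hXc : IsConnected X) :
    -- products
    (∀ K L : EuclideanSpace ℂ (Fin n) → EuclideanSpace ℂ (Fin n) → ℂ,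
      ProjKernel.IsProjInvKernel X K → ProjKernel.IsProjInvKernel X L →
      ProjKernel.IsProjInvKernel X (fun x y => K x y * L x y)) ∧
    -- rescalings
    (∀ K M : EuclideanSpace ℂ (Fin n) → EuclideanSpace ℂ (Fin n) → ℂ,
      ProjKernel.IsProjInvKernel X K → ProjKernel.IsRescaling X M K →
      (ProjKernel.IsPosSemidefKernel X M ∧ ProjKernel.IsRescaledByAut X M) ∧
      (ProjKernel.IsSesquiHolomorphic X M → ProjKernel.IsProjInvKernel X M)) ∧
    -- well-defined positive semi-definite real powers
    (∀ (K P : EuclideanSpace ℂ (Fin n) → EuclideanSpace ℂ (Fin n) → ℂ) (s : ℝ),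
      ProjKernel.IsProjInvKernel X K → ProjKernel.IsPower X s K P →
      ProjKernel.IsPosSemidefKernel X P →
      ProjKernel.IsProjInvKernel X P) ∧
    -- non-degenerate limits of nets in the compact-open topology
    (∀ (ι : Type*) (l : Filter ι) [l.NeBot]
      (K : ι → EuclideanSpace ℂ (Fin n) → EuclideanSpace ℂ (Fin n) → ℂ)
      (L : EuclideanSpace ℂ (Fin n) → EuclideanSpace ℂ (Fin n) → ℂ),
      (∀ i, ProjKernel.IsProjInvKernel X (K i)) →
      ProjKernel.CompactOpenTendsto X l K L →
      ProjKernel.IsNonDegenerate X L →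
      ProjKernel.IsProjInvKernel X L) := by
  refine ⟨fun K L hK hL => hK.mul hL, fun K M hK hM => ?_,
    fun K P s hK hP hPs => hK.power hXo hXc.isPreconnected hP hPs,
    fun ι l _ K L hK h hL => .of_compactOpenTendsto hXo hXc.isPreconnected hK h hL⟩
  have hpos := hK.posSemidef.of_isRescaling hM
  have haut := hK.rescaledByAut.of_isRescaling hM
  exact ⟨⟨hpos, haut⟩, fun hhol => ⟨hhol, hM.1, hpos, haut⟩⟩
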